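/- Let $q$ be a prime power and $3\le k\le m\le q$. Let $S_{q,k}$ be a $k\times\frac{q^k-1}{q-1}$ matrix over $\mathbb F_q$ any two columns of which are linearly independent (a generator matrix of a simplex code). Let $\gamma_1,\dots,\gamma_m\in\mathbb F_q$ be distinct, and let $G$ be the $k\times m$ matrix with columns $(\gamma_i^{k-1},\gamma_i^{k-2},\dots,\gamma_i,1)^T$, $1\le i\le m$; assume that the columns of $G$ occur among the columns of $S_{q,k}$. Let $\tilde C$ be the linear code generated by the rows of $G$, and let $C$ be the linear code generated by the rows of $S_{q,k}\setminus G$, the matrix obtained from $S_{q,k}$ by deleting the columns of $G$. Notation: for a linear code $D$ of length $n$ and dimension $\ell$ and a subspace $U\subseteq D$, let $w(U)$ be the number of coordinates at which some word of $U$ is nonzero. For $1\le r\le \ell$ put $d_r(D)=\min\{w(U) : U\subseteq D,\ \dim U=r\}$, and let $A^r_j(D)$ be the number of $r$-dimensional subspaces $U\subseteq D$ with $w(U)=j$; let $A_j(D)$ be the number of words of Hamming weight $j$ in $D$. Let $$\delta_r(D)=n-d_r(D)-\sum_{i=1}^{\ell-r}\left\lceil\frac{(q-1)d_r(D)}{q^i(q^r-1)}\right\rceil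 .$$ The code $D$ is called $r$-Griesmer if $r=\min\{1\le j\le \ell : \delta_j(D)=0\}$, Griesmer if it is $1$-Griesmer, and almost Griesmer if $\delta_1(D)=1$. It is called MDS if $d_1(D)=n-\ell+1$. Then $\tilde C$ is an MDS code of length $m$ and dimension $k$, $C$ has length $\frac{q^k-1}{q-1}-m$ and dimension $k$, and the following hold. (a) $d_r(C)=\frac{q^k-q^{k-r}}{q-1}-m$ for $1\le r\le k$. (b) For $1\le r\le k$, put $e_r=\frac{q^k-q^{k-r}}{q-1}$. Then $A^r_j(C)=A^r_{e_r-j}(\tilde C)$ for $e_r-m\le j\le e_r-m+k-r$, and $A^r_j(C)=0$ for all other $j\ge 0$. (c) If $m<q$, then $C$ is a Griesmer code. If $m=q$, then $C$ is a $2$-Griesmer code and an almost Griesmer code. (d) $A_0(C)=1$. For $q^{k-1}-m\le j\le q^{k-1}+k-m-1$, $$A_j(C)=\binom{m}{q^{k-1}-j}\sum_{t=0}^{q^{k-1}+k-j-m-1}(-1)^t\binom{q^{k-1}-j}{t}\left(q^{\,q^{k-1}+k-j-m-t}-1\right),$$ and $A_j(C)=0$ for every other $j\ge 1$. -/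

import Mathlib

namespace LinCode

variable {F : Type*} [Field F] {ι : Type*} [Fintype ι]

/-- The support of a set of words: the positions at which some word of the set is nonzero. -/
def supp (X : Set (ι → F)) : Set ι := {i | ∃ x ∈ X, x i ≠ 0}

/-- The (subcode) support weight `w(X) = |supp X|`. -/
noncomputable def suppWeight (X : Set (ι → F)) : ℕ := (supp X).ncard

/-- The `r`-generalized Hamming weight of a linear code: the least support weight of an
`r`-dimensional subcode. It is meant for `1 ≤ r ≤ dim C`, where the set below is nonempty. -/
noncomputable def ghw (C : Submodule F (ι → F)) (r : ℕ) : ℕ :=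
  sInf {w | ∃ U : Submodule F (ι → F),
    U ≤ C ∧ Module.finrank F U = r ∧ suppWeight (U : Set (ι → F)) = w}

/-- `A_j^r(C)`: the number of `r`-dimensional subcodes of support weight `j`. -/
noncomputable def sswd (C : Submodule F (ι → F)) (r j : ℕ) : ℕ :=
  {U : Submodule F (ι → F) |
    U ≤ C ∧ Module.finrank F U = r ∧ suppWeight (U : Set (ι → F)) = j}.ncard

/-- `A_j(C)`: the number of codewords of Hamming weight `j`. -/
noncomputable def weightDist [DecidableEq F] (C : Submodule F (ι → F)) (j : ℕ) : ℕ :=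
  {c : ι → F | c ∈ C ∧ hammingNorm c = j}.ncard

/-- The `r`-Griesmer defect
`δ_r(C) = n - d_r(C) - ∑_{i=1}^{k-r} ⌈(q-1) d_r(C) / (q^i (q^r - 1))⌉`
of a code of length `n` and dimension `k` over a field with `q` elements. -/
noncomputable def griesmerDefect [Fintype F] (C : Submodule F (ι → F)) (r : ℕ) : ℤ :=
  (Fintype.card ι : ℤ) - (ghw C r : ℤ)
    - ∑ i ∈ Finset.Icc 1 (Module.finrank F C - r),
        ⌈(((Fintype.card F : ℚ) - 1) * (ghw C r : ℚ))
          / ((Fintype.card F : ℚ) ^ i * ((Fintype.card F : ℚ) ^ r - 1))⌉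

/-- `C` is an `r`-Griesmer code: `r = min {1 ≤ j ≤ dim C | δ_j(C) = 0}`. -/
def IsRGriesmer [Fintype F] (C : Submodule F (ι → F)) (r : ℕ) : Prop :=
  IsLeast {j : ℕ | 1 ≤ j ∧ j ≤ Module.finrank F C ∧ griesmerDefect C j = 0} r

/-- Griesmer codes are the `1`-Griesmer codes. -/
def IsGriesmer [Fintype F] (C : Submodule F (ι → F)) : Prop := IsRGriesmer C 1

/-- Almost Griesmer codes: the `1`-Griesmer defect equals one. -/
def IsAlmostGriesmer [Fintype F] (C : Submodule F (ι → F)) : Prop := griesmerDefect C 1 = 1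

/-- A linear code is MDS when its minimum distance meets the Singleton bound, `d = n - k + 1`. -/
def IsMDS (C : Submodule F (ι → F)) : Prop :=
  ghw C 1 + Module.finrank F C = Fintype.card ι + 1

section Matrices

variable {κ μ : Type*} {F : Type*} [Field F] {ι : Type*}

/-- The linear code generated by the rows of a matrix. -/
def rowCode (M : Matrix κ ι F) : Submodule F (ι → F) := Submodule.span F (Set.range M.row)

/-- Every two (distinct) columns of the matrix are linearly independent. -/
def PairwiseIndepCols (S : Matrix κ ι F) : Prop :=
  ∀ i j : ι, i ≠ j → LinearIndependent F ![S.col i, S.col j]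

/-- Positions of the columns of `S` that are not columns of `G`. -/
abbrev RemainingCols (S : Matrix κ ι F) (G : Matrix κ μ F) : Type _ :=
  {j : ι // ∀ i : μ, S.col j ≠ G.col i}

/-- The matrix `S \ G`: the columns of `G` are deleted from `S`. -/
def deleteCols (S : Matrix κ ι F) (G : Matrix κ μ F) : Matrix κ (RemainingCols S G) F :=
  S.submatrix id Subtype.val

/-- The `k × m` matrix whose `i`-th column is `(γ_i^{k-1}, γ_i^{k-2}, …, γ_i, 1)`. -/
def grsMatrix (k m : ℕ) (γ : Fin m → F) : Matrix (Fin k) (Fin m) F :=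
  Matrix.of fun a i => γ i ^ (k - 1 - (a : ℕ))

end Matrices

end LinCode

/-! When `v ↦ v M` is injective, the `r`-dimensional subcodes of a row code correspond to the
`r`-dimensional message spaces `V`, and the support weight is the number of columns not orthogonal
to `V`. This puts `C`, `Ct` and the simplex code on the same message space.

The columns of `S` represent each projective point exactly once, so the simplex weight of `V`
depends only on its dimension: it is `e_r = (q^k - q^(k-r))/(q-1)`
(`colWeight_mul_add_of_pairwiseIndepCols`). Deleting the columns of `G` makes the weights of `V` in
`C` and in `Ct` add up to `e_r` (`colWeight_deleteCols_add`). Every claim about `C` thus becomes one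
about the Reed-Solomon type code `Ct`.

By interpolation, the weight of `V` in `Ct` lies between `m - (k - r)` and `m`, and `m` is attained.
This gives (a) and (b). Inclusion-exclusion over zero sets in `Ct` gives (d). For (c), the defect
turns into a sum of floors of `(q-1)m / (q^i (q^r - 1))` (`griesmerDefect_eq_sum_floor`). For `r =
1` all floors vanish if `m < q`, and only `i = 1` survives, with value 1, if `m = q`; for `r = 2`
all vanish. -/

namespace LinCode

open Matrix Module

/-! ### Subcodes and their weights in terms of message subspaces. -/

section ColWeight

variable {κ ι F : Type*} [Fintype κ] [Field F]

/-- The number of columns of `M` that are not orthogonal to the subspace `V`. -/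
noncomputable def colWeight (M : Matrix κ ι F) (V : Submodule F (κ → F)) : ℕ :=
  {i | ∃ v ∈ V, v ⬝ᵥ M.col i ≠ 0}.ncard

theorem suppWeight_map_vecMulLinear (M : Matrix κ ι F) (V : Submodule F (κ → F)) :
    suppWeight (V.map M.vecMulLinear : Set (ι → F)) = colWeight M V := by
  unfold suppWeight colWeight supp
  congr 1
  ext i
  simp [Matrix.vecMul, Matrix.col, Matrix.transpose]
  rfl

theorem rowCode_eq_range (M : Matrix κ ι F) : rowCode M = LinearMap.range M.vecMulLinear :=
  (range_vecMulLinear M).symm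

theorem finrank_rowCode {M : Matrix κ ι F} (hM : Function.Injective M.vecMulLinear) :
    finrank F (rowCode M) = Fintype.card κ := by
  rw [rowCode_eq_range, LinearMap.finrank_range_of_inj hM, Module.finrank_fintype_fun_eq_card]

theorem finrank_map_vecMulLinear {M : Matrix κ ι F} (hM : Function.Injective M.vecMulLinear)
    (V : Submodule F (κ → F)) : finrank F (V.map M.vecMulLinear) = finrank F V :=
  (Submodule.equivMapOfInjective _ hM V).finrank_eq.symm

/-- Subcodes of given dimension and support weight, in terms of subspaces of messages. -/
theorem setOf_subcode_eq_image {M : Matrix κ ι F} (hM : Function.Injective M.vecMulLinear)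
    (r j : ℕ) :
    {U : Submodule F (ι → F) |
      U ≤ rowCode M ∧ finrank F U = r ∧ suppWeight (U : Set (ι → F)) = j} =
    Submodule.map M.vecMulLinear ''
      {V : Submodule F (κ → F) | finrank F V = r ∧ colWeight M V = j} := by
  ext U
  simp only [Set.mem_ofPred_eq, Set.mem_image, rowCode_eq_range]
  constructor
  · rintro ⟨hU, hr, hj⟩
    have hmap : (U.comap M.vecMulLinear).map M.vecMulLinear = U := Submodule.map_comap_eq_of_le hU
    refine ⟨U.comap M.vecMulLinear, ⟨?_, ?_⟩, hmap⟩
    · rw [← finrank_map_vecMulLinear hM, hmap, hr]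
    · rw [← suppWeight_map_vecMulLinear, hmap, hj]
  · rintro ⟨V, ⟨hr, hj⟩, rfl⟩
    exact ⟨LinearMap.map_le_range, by rw [finrank_map_vecMulLinear hM, hr],
      by rw [suppWeight_map_vecMulLinear, hj]⟩

theorem sswd_rowCode {M : Matrix κ ι F} (hM : Function.Injective M.vecMulLinear) (r j : ℕ) :
    sswd (rowCode M) r j =
      {V : Submodule F (κ → F) | finrank F V = r ∧ colWeight M V = j}.ncard := by
  rw [sswd, setOf_subcode_eq_image hM,
    Set.ncard_image_of_injective _ (Submodule.map_injective_of_injective hM)]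

theorem ghw_rowCode_eq {M : Matrix κ ι F} (hM : Function.Injective M.vecMulLinear) {r d : ℕ}
    (hle : ∀ V : Submodule F (κ → F), finrank F V = r → d ≤ colWeight M V)
    {V : Submodule F (κ → F)} (hV : finrank F V = r) (hVd : colWeight M V = d) :
    ghw (rowCode M) r = d := by
  refine IsLeast.csInf_eq ⟨?_, ?_⟩
  · exact ⟨V.map M.vecMulLinear, by rw [rowCode_eq_range]; exact LinearMap.map_le_range,
      by rw [finrank_map_vecMulLinear hM, hV], by rw [suppWeight_map_vecMulLinear, hVd]⟩
  · intro w hw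
    obtain ⟨U, hU⟩ := hw
    obtain ⟨W, ⟨hW, hWw⟩, -⟩ := (setOf_subcode_eq_image hM r w).subset hU
    exact hWw ▸ hle W hW

theorem colWeight_span_singleton [Fintype ι] [DecidableEq F] (M : Matrix κ ι F) (v : κ → F) :
    colWeight M (F ∙ v) = hammingNorm (M.vecMulLinear v) := by
  rw [hammingNorm, ← Set.ncard_coe_finset, colWeight]
  congr 1
  ext i
  simp only [Set.mem_ofPred_eq, Finset.coe_filter, Finset.mem_univ, true_and]
  constructor
  · rintro ⟨w, hw, hne⟩
    obtain ⟨c, rfl⟩ := Submodule.mem_span_singleton.1 hw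
    rw [smul_dotProduct] at hne
    exact fun h => hne (by rw [show v ⬝ᵥ M.col i = 0 from h, smul_zero])
  · exact fun h => ⟨v, Submodule.mem_span_singleton_self v, h⟩

/-- A nonzero message in the kernel would span a line of column weight zero. The dimensions of both
codes rest on this criterion. -/
theorem vecMulLinear_injective_of_colWeight_pos [Fintype ι] {M : Matrix κ ι F}
    (h : ∀ V : Submodule F (κ → F), finrank F V = 1 → 0 < colWeight M V) :
    Function.Injective M.vecMulLinear := by
  classical
  rw [← LinearMap.ker_eq_bot, LinearMap.ker_eq_bot']
  intro v hv
  by_contra hne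
  have := h _ (finrank_span_singleton hne)
  rw [colWeight_span_singleton, hv, hammingNorm_zero] at this
  exact this.false

theorem weightDist_rowCode [Fintype ι] [DecidableEq F] {M : Matrix κ ι F}
    (hM : Function.Injective M.vecMulLinear) (j : ℕ) :
    weightDist (rowCode M) j = {v : κ → F | hammingNorm (M.vecMulLinear v) = j}.ncard := by
  rw [weightDist, ← Set.ncard_image_of_injective _ hM]
  congr 1
  ext c
  simp only [rowCode_eq_range, Set.mem_ofPred_eq, Set.mem_image, LinearMap.mem_range]
  constructor
  · rintro ⟨⟨v, rfl⟩, h⟩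
    exact ⟨v, h, rfl⟩
  · rintro ⟨v, h, rfl⟩
    exact ⟨⟨v, rfl⟩, h⟩

end ColWeight

/-! ### Deleting the columns of one matrix from another. -/

section Deletion

variable {κ μ ι F : Type*}

theorem col_injective [Field F] {S : Matrix κ ι F} (hS : PairwiseIndepCols S) :
    Function.Injective S.col := by
  intro i j hij
  by_contra hne
  have := hS i j hne
  rw [hij] at this
  exact absurd (this.injective (a₁ := 0) (a₂ := 1) (by simp)) (by simp)

/-- Deleting columns splits the column weight. -/
theorem colWeight_deleteCols_add [Fintype κ] [Fintype μ] [Fintype ι] [Field F] {S : Matrix κ ι F} {G : Matrix κ μ F}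
    [Fintype (RemainingCols S G)]
    (hS : Function.Injective S.col) (hG : Function.Injective G.col)
    (hGS : ∀ i, ∃ j, S.col j = G.col i) (V : Submodule F (κ → F)) :
    colWeight (deleteCols S G) V + colWeight G V = colWeight S V := by
  choose f hf using hGS
  have hfinj : Function.Injective f := fun a b hab => hG (by rw [← hf, ← hf, hab])
  unfold colWeight
  rw [← Set.ncard_image_of_injective {i | ∃ v ∈ V, v ⬝ᵥ (deleteCols S G).col i ≠ 0}
      Subtype.val_injective, ← Set.ncard_image_of_injective {i | ∃ v ∈ V, v ⬝ᵥ G.col i ≠ 0} hfinj,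
    ← Set.ncard_union_eq]
  · congr 1
    ext j
    simp only [Set.mem_union, Set.mem_image, Set.mem_ofPred_eq]
    constructor
    · rintro (⟨i, h, rfl⟩ | ⟨i, h, rfl⟩)
      · exact h
      · rwa [hf]
    · intro h
      by_cases hj : ∀ i, S.col j ≠ G.col i
      · exact Or.inl ⟨⟨j, hj⟩, h, rfl⟩
      · push Not at hj
        obtain ⟨i, hi⟩ := hj
        exact Or.inr ⟨i, by rwa [← hi], hS (by rw [hf, hi])⟩
  · rw [Set.disjoint_left]
    rintro _ ⟨i, -, rfl⟩ ⟨i', -, h⟩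
    exact i.2 i' (by rw [← h, hf])

theorem card_remainingCols_add [Fintype μ] [Fintype ι] {S : Matrix κ ι F} {G : Matrix κ μ F}
    [Fintype (RemainingCols S G)]
    (hS : Function.Injective S.col) (hG : Function.Injective G.col)
    (hGS : ∀ i, ∃ j, S.col j = G.col i) :
    Fintype.card (RemainingCols S G) + Fintype.card μ = Fintype.card ι := by
  classical
  choose f hf using hGS
  have hfinj : Function.Injective f := fun a b hab => hG (by rw [← hf, ← hf, hab])
  rw [← Finset.card_univ (α := μ), ← Finset.card_image_of_injective _ hfinj,
    ← Finset.card_compl_add_card (Finset.univ.image f), Fintype.card_subtype]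
  congr 2
  ext j
  simp only [Finset.mem_filter, Finset.mem_univ, true_and, Finset.mem_compl, Finset.mem_image,
    not_exists]
  refine forall_congr' fun i => not_congr ⟨fun h => hS (by rw [hf, h]), fun h => by rw [← h, hf]⟩

end Deletion

/-! ### Constant support weights of the simplex code. -/

section Simplex

variable {κ F : Type*} [Fintype κ] [Field F] [Fintype F]

/-- The number of vectors orthogonal to a subspace. -/
theorem ncard_orthogonal (V : Submodule F (κ → F)) :
    {y : κ → F | ∀ v ∈ V, v ⬝ᵥ y = 0}.ncard
      = Fintype.card F ^ (Fintype.card κ - finrank F V) := by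
  classical
  have h : {y : κ → F | ∀ v ∈ V, v ⬝ᵥ y = 0}
      = (dotProductEquiv F κ).symm '' (V.dualAnnihilator : Set (Dual F (κ → F))) := by
    ext y
    rw [LinearEquiv.image_symm_eq_preimage]
    simp [Submodule.mem_dualAnnihilator, dotProduct_comm]
  rw [h, Set.ncard_image_of_injective _ (LinearEquiv.injective _)]
  have h2 := Subspace.finrank_add_finrank_dualAnnihilator_eq V
  rw [Module.finrank_fintype_fun_eq_card] at h2
  have h3 := Module.natCard_eq_pow_finrank (K := F) (V := V.dualAnnihilator)
  rw [show finrank F V.dualAnnihilator = Fintype.card κ - finrank F V by omega,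
    Nat.card_eq_fintype_card (α := F)] at h3
  exact h3

/-- If the columns of `S` represent all points of the projective space, then column weights
are given by counting the points off a subspace. -/
theorem colWeight_mul_add_of_pairwiseIndepCols {N : ℕ} (hN : 2 ≤ N) {S : Matrix κ (Fin N) F}
    (hS : PairwiseIndepCols S)
    (hcard : N * (Fintype.card F - 1) + 1 = Fintype.card F ^ Fintype.card κ)
    (V : Submodule F (κ → F)) :
    colWeight S V * (Fintype.card F - 1) + Fintype.card F ^ (Fintype.card κ - finrank F V)
      = Fintype.card F ^ Fintype.card κ := by
  classical
  -- Pairwise independence excludes a zero column only if there is a second column to compare with,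
  -- hence `2 ≤ N`.
  have hne : ∀ j, S.col j ≠ 0 := by
    intro j hj
    have : Nontrivial (Fin N) := Fin.nontrivial_iff_two_le.2 hN
    obtain ⟨i, hi⟩ := exists_ne j
    exact (hS j i hi.symm).ne_zero 0 (by simpa using hj)
  -- Nonzero multiples of columns are distinct nonzero vectors, and `hcard` says there are enough of
  -- them to exhaust all nonzero vectors.
  let f : Fˣ × Fin N → (κ → F) := fun p => p.1 • S.col p.2
  have hf : Function.Injective f := by
    rintro ⟨c, i⟩ ⟨d, j⟩ h
    change (c : F) • S.col i = (d : F) • S.col j at h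
    by_cases hij : i = j
    · subst hij
      rw [Prod.mk.injEq]
      exact ⟨Units.ext (smul_left_injective F (hne i) h), rfl⟩
    · have := (LinearIndependent.pair_iff.1 (hS i j hij)) c (-d) (by rw [h]; simp)
      exact absurd this.1 c.ne_zero
  have hrange : Finset.univ.image f = {0}ᶜ := by
    refine Finset.eq_of_subset_of_card_le ?_ ?_
    · intro y hy
      simp only [Finset.mem_image, Finset.mem_univ, true_and, Prod.exists] at hy
      obtain ⟨c, i, rfl⟩ := hy
      simp only [Finset.mem_compl, Finset.mem_singleton]
      change (c : F) • S.col i ≠ 0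
      exact smul_ne_zero c.ne_zero (hne i)
    · rw [Finset.card_image_of_injective _ hf, Finset.card_compl, Finset.card_univ,
        Fintype.card_prod, Fintype.card_units, Fintype.card_fin,
        Fintype.card_fun, Finset.card_singleton, ← hcard, mul_comm]
      omega
  -- Orthogonality to `V` is invariant under nonzero scaling, so each column counted by `colWeight`
  -- accounts for `q - 1` vectors off the orthogonal space.
  have himage : {y : κ → F | ∀ v ∈ V, v ⬝ᵥ y = 0}ᶜ
      = f '' (Set.univ ×ˢ {i | ∃ v ∈ V, v ⬝ᵥ S.col i ≠ 0}) := by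
    ext y
    simp only [Set.mem_compl_iff, Set.mem_ofPred_eq, Set.mem_image, Set.mem_prod, Set.mem_univ,
      true_and, not_forall, exists_prop]
    constructor
    · rintro ⟨v, hv, hy⟩
      have hy0 : y ∈ ({0}ᶜ : Finset (κ → F)) := by
        simp only [Finset.mem_compl, Finset.mem_singleton]
        rintro rfl
        simp at hy
      rw [← hrange] at hy0
      obtain ⟨⟨c, i⟩, -, rfl⟩ := Finset.mem_image.1 hy0
      refine ⟨(c, i), ⟨v, hv, fun h => hy ?_⟩, rfl⟩
      change v ⬝ᵥ ((c : F) • S.col i) = 0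
      rw [dotProduct_smul, h, smul_zero]
    · rintro ⟨⟨c, i⟩, ⟨v, hv, h⟩, rfl⟩
      refine ⟨v, hv, ?_⟩
      change ¬ v ⬝ᵥ ((c : F) • S.col i) = 0
      rw [dotProduct_smul]
      exact smul_ne_zero c.ne_zero h
  have key := Set.ncard_add_ncard_compl {y : κ → F | ∀ v ∈ V, v ⬝ᵥ y = 0}
  rw [himage, Set.ncard_image_of_injective _ hf, Set.ncard_prod, Set.ncard_univ,
    Nat.card_eq_fintype_card, Fintype.card_units, ncard_orthogonal, Nat.card_eq_fintype_card,
    Fintype.card_fun] at key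
  rw [← key, colWeight]
  ring

end Simplex

/-! ### Evaluation codes at distinct points and their support weights. -/

section ReedSolomon

variable {F : Type*} [Field F] {k m : ℕ}

theorem dotProduct_grsMatrix_col (γ : Fin m → F) (v : Fin k → F) (i : Fin m) :
    v ⬝ᵥ (grsMatrix k m γ).col i = ∑ a : Fin k, v a.rev * γ i ^ (a : ℕ) := by
  rw [dotProduct, ← Equiv.sum_comp Fin.revPerm]
  refine Finset.sum_congr rfl fun a _ => ?_
  simp only [grsMatrix, Matrix.col_apply, Matrix.of_apply, Fin.revPerm_apply, Fin.val_rev]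
  congr 2
  have := a.2
  omega

/-- Lagrange interpolation: values at `k` or fewer points can be prescribed. -/
theorem exists_dotProduct_grsMatrix_col_eq {γ : Fin m → F} (hγ : Function.Injective γ)
    (T : Finset (Fin m)) (hT : T.card ≤ k) (y : Fin m → F) :
    ∃ v : Fin k → F, ∀ i ∈ T, v ⬝ᵥ (grsMatrix k m γ).col i = y i := by
  let p := Lagrange.interpolate T γ y
  rcases Nat.eq_zero_or_pos k with hk | hk
  · have : T = ∅ := Finset.card_eq_zero.1 (by omega)
    subst this
    exact ⟨0, by simp⟩
  have hdeg : p.natDegree < k := by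
    have h : p.degree < T.card := Lagrange.degree_interpolate_lt y hγ.injOn
    by_cases hp : p = 0
    · rw [hp]; simpa using hk
    · rw [Polynomial.degree_eq_natDegree hp] at h
      exact lt_of_lt_of_le (by exact_mod_cast h) hT
  -- The columns list powers in decreasing order, so the coefficients are reversed.
  refine ⟨fun a => p.coeff a.rev, fun i hi => ?_⟩
  rw [dotProduct_grsMatrix_col, ← Lagrange.eval_interpolate_at_node y hγ.injOn hi,
    Polynomial.eval_eq_sum_range' hdeg, Finset.sum_range]
  simp

/-- The messages whose codewords vanish on `T`. -/
def vanishingMessages (γ : Fin m → F) (k : ℕ) (T : Finset (Fin m)) :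
    Submodule F (Fin k → F) where
  carrier := {v | ∀ i ∈ T, v ⬝ᵥ (grsMatrix k m γ).col i = 0}
  add_mem' {v w} hv hw i hi := by rw [add_dotProduct, hv i hi, hw i hi, add_zero]
  zero_mem' i _ := zero_dotProduct _
  smul_mem' c v hv i hi := by rw [smul_dotProduct, hv i hi, smul_zero]

theorem mem_vanishingMessages {γ : Fin m → F} {T : Finset (Fin m)} {v : Fin k → F} :
    v ∈ vanishingMessages γ k T ↔ ∀ i ∈ T, v ⬝ᵥ (grsMatrix k m γ).col i = 0 := Iff.rfl

/-- For at most `k` points, evaluation on `T` is onto by interpolation, and rank-nullity applies.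
For more points, a `k`-subset already forces the space to be zero, matching the truncated
subtraction. -/
theorem finrank_vanishingMessages {γ : Fin m → F} (hγ : Function.Injective γ)
    (T : Finset (Fin m)) : finrank F (vanishingMessages γ k T) = k - T.card := by
  wlog hT : T.card ≤ k generalizing T
  · obtain ⟨T', hT', hc⟩ := Finset.exists_subset_card_eq (s := T) (n := k) (by omega)
    have h := this T' hc.le
    have hle : vanishingMessages γ k T ≤ vanishingMessages γ k T' :=
      fun v hv i hi => hv i (hT' hi)
    have := Submodule.finrank_mono hle
    omega
  let e : (Fin k → F) →ₗ[F] (T → F) :=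
    LinearMap.pi fun i => (LinearMap.proj (i : Fin m)).comp (grsMatrix k m γ).vecMulLinear
  have he : ∀ v i, e v i = v ⬝ᵥ (grsMatrix k m γ).col i := fun v i => rfl
  have hker : LinearMap.ker e = vanishingMessages γ k T := by
    ext v
    rw [LinearMap.mem_ker, mem_vanishingMessages, funext_iff]
    simp [he]
  have hsurj : Function.Surjective e := by
    intro y
    obtain ⟨v, hv⟩ := exists_dotProduct_grsMatrix_col_eq hγ T hT
      (fun i => if h : i ∈ T then y ⟨i, h⟩ else 0)
    refine ⟨v, funext fun i => ?_⟩
    rw [he, hv i i.2, dif_pos i.2]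
  have h := e.finrank_range_add_finrank_ker
  rw [hker, LinearMap.range_eq_top.2 hsurj, finrank_top, Module.finrank_fintype_fun_eq_card,
    Module.finrank_fin_fun, Fintype.card_coe] at h
  omega

theorem colWeight_le_card {κ ι : Type*} [Fintype κ] [Fintype ι] (M : Matrix κ ι F)
    (V : Submodule F (κ → F)) : colWeight M V ≤ Fintype.card ι := by
  rw [← Nat.card_eq_fintype_card, ← Set.ncard_univ]
  exact Set.ncard_le_ncard (Set.subset_univ _)

/-- The generalized Singleton bound is attained by evaluation codes. -/
theorem le_colWeight_grsMatrix_add {γ : Fin m → F} (hγ : Function.Injective γ)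
    {V : Submodule F (Fin k → F)} (hV : 1 ≤ finrank F V) :
    m ≤ colWeight (grsMatrix k m γ) V + (k - finrank F V) := by
  classical
  have key := Set.ncard_add_ncard_compl {i | ∃ v ∈ V, v ⬝ᵥ (grsMatrix k m γ).col i ≠ 0}
  rw [Nat.card_eq_fintype_card, Fintype.card_fin] at key
  let T : Finset (Fin m) := Finset.univ.filter fun i => ∀ v ∈ V, v ⬝ᵥ (grsMatrix k m γ).col i = 0
  have hT : {i | ∃ v ∈ V, v ⬝ᵥ (grsMatrix k m γ).col i ≠ 0}ᶜ = (T : Set (Fin m)) := by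
    ext i
    simp [T]
  rw [hT, Set.ncard_coe_finset] at key
  -- `T` is the set of common zeros of `V`, so `dim V ≤ k - |T|`; as `dim V ≥ 1`, the subtraction is
  -- not truncated.
  have hle : V ≤ vanishingMessages γ k T := fun v hv i hi => (Finset.mem_filter.1 hi).2 v hv
  have h := Submodule.finrank_mono hle
  rw [finrank_vanishingMessages hγ] at h
  unfold colWeight
  omega

theorem grsMatrix_col_injective (hk : 2 ≤ k) {γ : Fin m → F} (hγ : Function.Injective γ) :
    Function.Injective (grsMatrix k m γ).col := by
  intro i j hij
  apply hγ
  have := congrFun hij ⟨k - 2, by omega⟩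
  simpa [grsMatrix, show k - 1 - (k - 2) = 1 by omega] using this

/-- Subspaces of messages containing the constant polynomial `1` have full column weight. -/
theorem exists_colWeight_grsMatrix_eq (γ : Fin m → F) {r : ℕ} (hr : 1 ≤ r) (hrk : r ≤ k) :
    ∃ V : Submodule F (Fin k → F), finrank F V = r ∧ colWeight (grsMatrix k m γ) V = m := by
  classical
  -- The last row of the matrix is the all-ones row.
  let a : Fin k := ⟨k - 1, by omega⟩
  obtain ⟨A, hA, hAr⟩ := Finset.exists_superset_card_eq (s := {a}) (n := r) (by simpa using hr)
    (by simpa using hrk)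
  have hli : LinearIndependent F (fun b : A => (Pi.single (b : Fin k) 1 : Fin k → F)) := by
    have := (Pi.basisFun F (Fin k)).linearIndependent.comp (fun b : A => (b : Fin k))
      Subtype.val_injective
    simpa [Function.comp_def] using this
  refine ⟨Submodule.span F (Set.range fun b : A => (Pi.single (b : Fin k) 1 : Fin k → F)), ?_, ?_⟩
  · rw [finrank_span_eq_card hli, Fintype.card_coe, hAr]
  · have : {i | ∃ v ∈ Submodule.span F
        (Set.range fun b : A => (Pi.single (b : Fin k) 1 : Fin k → F)),
        v ⬝ᵥ (grsMatrix k m γ).col i ≠ 0} = Set.univ := by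
      refine Set.eq_univ_of_forall fun i => ⟨Pi.single a 1, Submodule.subset_span
        ⟨⟨a, hA (Finset.mem_singleton_self a)⟩, rfl⟩, ?_⟩
      simp [grsMatrix, a]
    rw [colWeight, this, Set.ncard_univ, Nat.card_eq_fintype_card, Fintype.card_fin]

theorem vecMulLinear_grsMatrix_injective (hkm : k ≤ m) {γ : Fin m → F}
    (hγ : Function.Injective γ) : Function.Injective (grsMatrix k m γ).vecMulLinear := by
  refine vecMulLinear_injective_of_colWeight_pos fun V hV => ?_
  have h := le_colWeight_grsMatrix_add hγ hV.ge
  have h2 : finrank F V ≤ k := by simpa using Submodule.finrank_le V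
  omega

/-- Evaluation codes are MDS. -/
theorem isMDS_rowCode_grsMatrix (hk : 1 ≤ k) (hkm : k ≤ m) {γ : Fin m → F}
    (hγ : Function.Injective γ) : IsMDS (rowCode (grsMatrix k m γ)) := by
  have hinj := vecMulLinear_grsMatrix_injective hkm hγ
  -- Vanishing at `k - 1` points leaves a single line of messages, which attains the Singleton
  -- bound.
  obtain ⟨T, -, hT⟩ := Finset.exists_subset_card_eq (s := (Finset.univ : Finset (Fin m)))
    (n := k - 1) (by rw [Finset.card_univ, Fintype.card_fin]; omega)
  have hfin : finrank F (vanishingMessages γ k T) = 1 := by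
    rw [finrank_vanishingMessages hγ, hT]
    omega
  have hlow : ∀ V : Submodule F (Fin k → F), finrank F V = 1 →
      m - (k - 1) ≤ colWeight (grsMatrix k m γ) V := by
    intro V hV
    have h := le_colWeight_grsMatrix_add hγ hV.ge
    rw [hV] at h
    omega
  have hup : colWeight (grsMatrix k m γ) (vanishingMessages γ k T) ≤ m - (k - 1) := by
    classical
    have hsub : {i | ∃ v ∈ vanishingMessages γ k T, v ⬝ᵥ (grsMatrix k m γ).col i ≠ 0}
        ⊆ ((Tᶜ : Finset (Fin m)) : Set (Fin m)) := by
      rintro i ⟨v, hv, hne⟩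
      simp only [Finset.coe_compl, Set.mem_compl_iff, Finset.mem_coe]
      exact fun hi => hne (hv i hi)
    have := Set.ncard_le_ncard hsub
    rwa [Set.ncard_coe_finset, Finset.card_compl, hT, Fintype.card_fin] at this
  have hghw := ghw_rowCode_eq hinj hlow hfin (le_antisymm hup (hlow _ hfin))
  rw [IsMDS, hghw, finrank_rowCode hinj, Fintype.card_fin, Fintype.card_fin]
  omega

end ReedSolomon

/-! ### Weight distribution of evaluation codes by inclusion-exclusion. -/

section WeightDistribution

variable {F : Type*} [Field F] [Fintype F] [DecidableEq F] {k m : ℕ}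

theorem card_vanishingMessages {γ : Fin m → F} (hγ : Function.Injective γ)
    (T : Finset (Fin m)) :
    (Finset.univ.filter fun v : Fin k → F =>
      ∀ i ∈ T, v ⬝ᵥ (grsMatrix k m γ).col i = 0).card = Fintype.card F ^ (k - T.card) := by
  classical
  have h := Module.natCard_eq_pow_finrank (K := F) (V := vanishingMessages γ k T)
  rw [finrank_vanishingMessages hγ, Nat.card_eq_fintype_card (α := F)] at h
  rw [← h, ← Set.ncard_coe_finset]
  simp only [Finset.coe_filter, Finset.mem_univ, true_and]
  rfl

/-- Inclusion-exclusion for the number of messages whose codeword has a given zero set. -/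
theorem card_zeroSet_eq {γ : Fin m → F} (hγ : Function.Injective γ) {Z : Finset (Fin m)}
    (hZ : Z.card < m) :
    ((Finset.univ.filter fun v : Fin k → F =>
      (Finset.univ.filter fun i => v ⬝ᵥ (grsMatrix k m γ).col i = 0) = Z).card : ℤ)
    = ∑ t ∈ Finset.range (k - Z.card), (-1 : ℤ) ^ t * ((m - Z.card).choose t : ℤ)
        * ((Fintype.card F : ℤ) ^ (k - Z.card - t) - 1) := by
  have hind : ∀ v : Fin k → F,
      (if (Finset.univ.filter fun i => v ⬝ᵥ (grsMatrix k m γ).col i = 0) = Z then (1 : ℤ) else 0)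
      = ∑ T ∈ Zᶜ.powerset, (-1 : ℤ) ^ T.card *
        (if ∀ i ∈ Z ∪ T, v ⬝ᵥ (grsMatrix k m γ).col i = 0 then 1 else 0) := by
    intro v
    set W := Finset.univ.filter fun i => v ⬝ᵥ (grsMatrix k m γ).col i = 0 with hW
    have hcond : ∀ T : Finset (Fin m),
        (∀ i ∈ Z ∪ T, v ⬝ᵥ (grsMatrix k m γ).col i = 0) ↔ Z ⊆ W ∧ T ⊆ W := by
      intro T
      rw [← Finset.union_subset_iff]
      simp [hW, Finset.subset_iff]
    simp only [hcond]
    -- Once `Z ⊆ W`, the surviving sets are the subsets of `W \ Z`; their alternating sum vanishes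
    -- unless `W = Z`.
    by_cases hZW : Z ⊆ W
    · have : ∑ T ∈ Zᶜ.powerset, (-1 : ℤ) ^ T.card * (if Z ⊆ W ∧ T ⊆ W then 1 else 0)
          = ∑ T ∈ (W \ Z).powerset, (-1 : ℤ) ^ T.card := by
        simp only [hZW, true_and, mul_ite, mul_one, mul_zero]
        rw [← Finset.sum_filter]
        refine Finset.sum_congr ?_ fun _ _ => rfl
        ext T
        simp only [Finset.mem_filter, Finset.mem_powerset, Finset.subset_iff, Finset.mem_compl,
          Finset.mem_sdiff]
        grind
      rw [this, Finset.sum_powerset_neg_one_pow_card]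
      refine if_congr ?_ rfl rfl
      rw [Finset.sdiff_eq_empty_iff_subset]
      exact ⟨fun h => h.le, fun h => h.antisymm hZW⟩
    · rw [if_neg (fun h => hZW h.ge), Finset.sum_eq_zero]
      intro T _
      rw [if_neg (fun h => hZW h.1), mul_zero]
  -- Since `Z` is not everything, 1 may be subtracted from each power of `q` at no cost. This kills
  -- the terms with `|Z| + |T| ≥ k`, where the exponent is truncated.
  have hbin : ∑ T ∈ Zᶜ.powerset, (-1 : ℤ) ^ T.card = 0 := by
    rw [Finset.sum_powerset_neg_one_pow_card, if_neg]
    rw [← Finset.card_eq_zero, Finset.card_compl, Fintype.card_fin]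
    omega
  calc _ = ∑ v : Fin k → F, ∑ T ∈ Zᶜ.powerset, (-1 : ℤ) ^ T.card *
        (if ∀ i ∈ Z ∪ T, v ⬝ᵥ (grsMatrix k m γ).col i = 0 then 1 else 0) := by
        rw [Finset.card_filter]
        push_cast
        exact Finset.sum_congr rfl fun v _ => hind v
    _ = ∑ T ∈ Zᶜ.powerset, (-1 : ℤ) ^ T.card * (Fintype.card F : ℤ) ^ (k - Z.card - T.card) := by
        rw [Finset.sum_comm]
        refine Finset.sum_congr rfl fun T hT => ?_
        rw [← Finset.mul_sum]
        congr 1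
        have hdisj : Disjoint Z T := by
          rw [Finset.mem_powerset] at hT
          exact (disjoint_compl_right (a := Z)).mono_right hT
        have := card_vanishingMessages (k := k) hγ (Z ∪ T)
        rw [Finset.card_union_of_disjoint hdisj, ← Nat.sub_sub, Finset.card_filter] at this
        exact_mod_cast this
    _ = ∑ T ∈ Zᶜ.powerset,
          (-1 : ℤ) ^ T.card * ((Fintype.card F : ℤ) ^ (k - Z.card - T.card) - 1) := by
        simp only [mul_sub, mul_one, Finset.sum_sub_distrib, hbin, sub_zero]
    _ = ∑ t ∈ Finset.range (m - Z.card + 1), (-1 : ℤ) ^ t * ((m - Z.card).choose t : ℤ)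
        * ((Fintype.card F : ℤ) ^ (k - Z.card - t) - 1) := by
        rw [Finset.sum_powerset_apply_card
          (fun t => (-1 : ℤ) ^ t * ((Fintype.card F : ℤ) ^ (k - Z.card - t) - 1)),
          Finset.card_compl, Fintype.card_fin]
        refine Finset.sum_congr rfl fun t _ => ?_
        rw [nsmul_eq_mul]
        ring
    _ = _ := by
        have hA : ∀ t, m - Z.card < t → (-1 : ℤ) ^ t * ((m - Z.card).choose t : ℤ)
            * ((Fintype.card F : ℤ) ^ (k - Z.card - t) - 1) = 0 := by
          intro t ht
          rw [Nat.choose_eq_zero_of_lt ht]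
          simp
        have hB : ∀ t, k - Z.card ≤ t → (-1 : ℤ) ^ t * ((m - Z.card).choose t : ℤ)
            * ((Fintype.card F : ℤ) ^ (k - Z.card - t) - 1) = 0 := by
          intro t ht
          rw [Nat.sub_eq_zero_of_le ht]
          simp
        rcases le_total (m - Z.card + 1) (k - Z.card) with h | h
        · exact Finset.sum_subset (Finset.range_mono h) fun t _ ht => hA t (by
            rw [Finset.mem_range] at ht; omega)
        · exact (Finset.sum_subset (Finset.range_mono h) fun t _ ht => hB t (by
            rw [Finset.mem_range] at ht; omega)).symm

/-- The weight distribution of an evaluation code. -/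
theorem ncard_hammingNorm_grsMatrix {γ : Fin m → F} (hγ : Function.Injective γ) {w : ℕ}
    (hw : 1 ≤ w) (hwm : w ≤ m) :
    ({v : Fin k → F | hammingNorm ((grsMatrix k m γ).vecMulLinear v) = w}.ncard : ℤ)
    = (m.choose w : ℤ) * ∑ t ∈ Finset.range (k - (m - w)), (-1 : ℤ) ^ t * (w.choose t : ℤ)
        * ((Fintype.card F : ℤ) ^ (k - (m - w) - t) - 1) := by
  have hset : {v : Fin k → F | hammingNorm ((grsMatrix k m γ).vecMulLinear v) = w}
      = ((Finset.univ.filter fun v : Fin k → F =>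
          (Finset.univ.filter fun i => v ⬝ᵥ (grsMatrix k m γ).col i = 0)
            ∈ Finset.powersetCard (m - w) Finset.univ : Finset (Fin k → F)) : Set (Fin k → F)) := by
    ext v
    have h := Finset.card_filter_add_card_filter_not (s := (Finset.univ : Finset (Fin m)))
      (fun i => v ⬝ᵥ (grsMatrix k m γ).col i = 0)
    rw [Finset.card_univ, Fintype.card_fin] at h
    have h2 : hammingNorm ((grsMatrix k m γ).vecMulLinear v)
      = (Finset.univ.filter fun i => ¬ v ⬝ᵥ (grsMatrix k m γ).col i = 0).card := rfl
    simp only [Set.mem_ofPred_eq, Finset.coe_filter, Finset.mem_univ, true_and,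
      Finset.mem_powersetCard, Finset.subset_univ, h2]
    omega
  -- Weight `w` means exactly `m - w` zeros; messages are sorted by their zero set, and each fiber
  -- has the same size.
  have hfiber := Finset.card_eq_sum_card_fiberwise (t := Finset.powersetCard (m - w) Finset.univ)
      (f := fun v : Fin k → F => Finset.univ.filter fun i => v ⬝ᵥ (grsMatrix k m γ).col i = 0)
      (s := Finset.univ.filter fun v => (Finset.univ.filter fun i =>
        v ⬝ᵥ (grsMatrix k m γ).col i = 0) ∈ Finset.powersetCard (m - w) Finset.univ)
      (fun v hv => (Finset.mem_filter.1 (Finset.mem_coe.1 hv)).2)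
  rw [hset, Set.ncard_coe_finset, hfiber]
  push_cast
  rw [Finset.sum_congr rfl (g := fun _ => ∑ t ∈ Finset.range (k - (m - w)),
    (-1 : ℤ) ^ t * (w.choose t : ℤ) * ((Fintype.card F : ℤ) ^ (k - (m - w) - t) - 1))]
  · rw [Finset.sum_const, Finset.card_powersetCard, Finset.card_univ, Fintype.card_fin,
      Nat.choose_symm hwm, nsmul_eq_mul]
  · intro Z hZ
    have hc := (Finset.mem_powersetCard.1 hZ).2
    have := card_zeroSet_eq (k := k) hγ (Z := Z) (by omega)
    rw [hc, show m - (m - w) = w by omega] at this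
    rw [← this, Finset.filter_filter]
    congr 2
    ext v
    simp only [Finset.mem_filter, Finset.mem_univ, true_and]
    exact ⟨fun h => h.2, fun h => ⟨h ▸ hZ, h⟩⟩

end WeightDistribution

/-! ### Arithmetic of the Griesmer defect. -/

section Griesmer

theorem sum_Icc_pow_sub_mul (q n : ℕ) :
    (∑ i ∈ Finset.Icc 1 n, (q : ℚ) ^ (n - i)) * ((q : ℚ) - 1) = (q : ℚ) ^ n - 1 := by
  rw [← geom_sum_mul, ← Finset.sum_range_reflect, Finset.range_eq_Ico,
    Finset.sum_Ico_eq_sum_range, Finset.sum_bij (fun i _ => i - 1)]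
  · intro i hi
    rw [Finset.mem_Icc] at hi
    rw [Finset.mem_range]
    omega
  · intro i hi j hj h
    rw [Finset.mem_Icc] at hi hj
    omega
  · intro j hj
    rw [Finset.mem_range] at hj
    exact ⟨j + 1, by rw [Finset.mem_Icc]; omega, by omega⟩
  · intro i hi
    rw [Finset.mem_Icc] at hi
    congr 1
    omega

/-- The Griesmer defect of a code with the parameters of a punctured simplex code. -/
theorem griesmerDefect_eq_sum_floor {F : Type*} [Field F] [Fintype F] {ι : Type*} [Fintype ι]
    (C : Submodule F (ι → F)) {k m r : ℕ} (hr : 1 ≤ r) (hrk : r ≤ k) (hfin : finrank F C = k)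
    (hcard : ((Fintype.card ι : ℚ) + m) * ((Fintype.card F : ℚ) - 1)
      = (Fintype.card F : ℚ) ^ k - 1)
    (hghw : (ghw C r : ℚ) = ((Fintype.card F : ℚ) ^ k - (Fintype.card F : ℚ) ^ (k - r))
      / ((Fintype.card F : ℚ) - 1) - (m : ℚ)) :
    griesmerDefect C r = ∑ i ∈ Finset.Icc 1 (k - r),
      ⌊((Fintype.card F : ℚ) - 1) * m
        / ((Fintype.card F : ℚ) ^ i * ((Fintype.card F : ℚ) ^ r - 1))⌋ := by
  have hq1 : 1 < Fintype.card F := Fintype.one_lt_card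
  rw [griesmerDefect, hfin]
  generalize Fintype.card F = q at *
  have hqQ : (1 : ℚ) < q := by exact_mod_cast hq1
  have hne : (q : ℚ) - 1 ≠ 0 := by linarith
  have hne0 : (q : ℚ) ≠ 0 := by linarith
  have hner : (q : ℚ) ^ r - 1 ≠ 0 := by
    have := one_lt_pow₀ hqQ (show r ≠ 0 by omega)
    linarith
  -- The simplex part of `d_r` contributes the integer `q^(k-r-i)`, which leaves the ceiling; the
  -- part from `m` becomes minus a floor.
  have hterm : ∀ i ∈ Finset.Icc 1 (k - r),
      ⌈(((q : ℚ) - 1) * (ghw C r : ℚ)) / ((q : ℚ) ^ i * ((q : ℚ) ^ r - 1))⌉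
      = (q : ℤ) ^ (k - r - i) - ⌊((q : ℚ) - 1) * m / ((q : ℚ) ^ i * ((q : ℚ) ^ r - 1))⌋ := by
    intro i hi
    rw [Finset.mem_Icc] at hi
    have hpow : (q : ℚ) ^ (k - r) = (q : ℚ) ^ (k - r - i) * (q : ℚ) ^ i := by
      rw [← pow_add]
      congr 1
      omega
    have hpow2 : (q : ℚ) ^ k = (q : ℚ) ^ (k - r) * (q : ℚ) ^ r := by
      rw [← pow_add]
      congr 1
      omega
    have : (((q : ℚ) - 1) * (ghw C r : ℚ)) / ((q : ℚ) ^ i * ((q : ℚ) ^ r - 1))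
        = (((q : ℤ) ^ (k - r - i) : ℤ) : ℚ)
          + -(((q : ℚ) - 1) * m / ((q : ℚ) ^ i * ((q : ℚ) ^ r - 1))) := by
      rw [hghw, hpow2, hpow]
      push_cast
      field_simp
      ring
    rw [this, Int.ceil_intCast_add, Int.ceil_neg]
    ring
  rw [Finset.sum_congr rfl hterm, Finset.sum_sub_distrib]
  -- In `n - d_r` the two copies of `m` cancel, leaving a geometric sum that offsets the integer
  -- parts above.
  have hmain : ((Fintype.card ι : ℚ) - ghw C r)
      = ∑ i ∈ Finset.Icc 1 (k - r), (q : ℚ) ^ (k - r - i) := by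
    apply mul_right_cancel₀ hne
    rw [sum_Icc_pow_sub_mul, hghw]
    have : (Fintype.card ι : ℚ) * ((q : ℚ) - 1) = (q : ℚ) ^ k - 1 - m * ((q : ℚ) - 1) := by
      linarith
    rw [sub_mul, this, sub_mul, div_mul_cancel₀ _ hne]
    ring
  have hmainZ : (Fintype.card ι : ℤ) - ghw C r
      = ∑ i ∈ Finset.Icc 1 (k - r), (q : ℤ) ^ (k - r - i) := by exact_mod_cast hmain
  rw [hmainZ]
  ring

end Griesmer

end LinCode

/-- All natural-number divisions below are exact, and the natural-number subtractions
do not truncate under the stated conditions. -/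
theorem mainTheorem4
    {F : Type*} [Field F] [Fintype F] [DecidableEq F]
    (q k m : ℕ) (hq : Fintype.card F = q)
    (hk : 3 ≤ k) (hkm : k ≤ m) (hmq : m ≤ q)
    (γ : Fin m → F) (hγ : Function.Injective γ)
    (S : Matrix (Fin k) (Fin ((q ^ k - 1) / (q - 1))) F)
    (hS : LinCode.PairwiseIndepCols S)
    (hGS : ∀ i : Fin m, ∃ j, S.col j = (LinCode.grsMatrix k m γ).col i)
    (Ct : Submodule F (Fin m → F))
    (hCt : Ct = LinCode.rowCode (LinCode.grsMatrix k m γ))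
    (C : Submodule F (LinCode.RemainingCols S (LinCode.grsMatrix k m γ) → F))
    (hC : C = LinCode.rowCode (LinCode.deleteCols S (LinCode.grsMatrix k m γ))) :
    -- parameters: `Ct` is an MDS `[m, k]` code, `C` is a `[(q^k - 1)/(q - 1) - m, k]` code
    (Module.finrank F Ct = k ∧ LinCode.IsMDS Ct ∧
      Module.finrank F C = k ∧
      Fintype.card (LinCode.RemainingCols S (LinCode.grsMatrix k m γ)) + m
        = (q ^ k - 1) / (q - 1)) ∧
    -- (a) generalized Hamming weights
    (∀ r : ℕ, 1 ≤ r → r ≤ k →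
      (LinCode.ghw C r : ℚ) = ((q : ℚ) ^ k - (q : ℚ) ^ (k - r)) / ((q : ℚ) - 1) - (m : ℚ)) ∧
    -- (b) subcode support weight distributions
    (∀ r : ℕ, 1 ≤ r → r ≤ k → ∀ j : ℕ,
      (j + m < (q ^ k - q ^ (k - r)) / (q - 1) → LinCode.sswd C r j = 0) ∧
      ((q ^ k - q ^ (k - r)) / (q - 1) ≤ j + m →
        j + m ≤ (q ^ k - q ^ (k - r)) / (q - 1) + (k - r) →
        LinCode.sswd C r j = LinCode.sswd Ct r ((q ^ k - q ^ (k - r)) / (q - 1) - j)) ∧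
      ((q ^ k - q ^ (k - r)) / (q - 1) + (k - r) < j + m → LinCode.sswd C r j = 0)) ∧
    -- (c) Griesmer properties
    ((m < q → LinCode.IsGriesmer C) ∧
      (m = q → LinCode.IsRGriesmer C 2 ∧ LinCode.IsAlmostGriesmer C)) ∧
    -- (d) weight distribution
    (LinCode.weightDist C 0 = 1 ∧
      ∀ j : ℕ, 1 ≤ j →
        (q ^ (k - 1) ≤ j + m → j + m + 1 ≤ q ^ (k - 1) + k →
          (LinCode.weightDist C j : ℤ)
            = ((m.choose (q ^ (k - 1) - j) : ℕ) : ℤ)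
              * ∑ t ∈ Finset.range (q ^ (k - 1) + k - j - m),
                  (-1 : ℤ) ^ t * (((q ^ (k - 1) - j).choose t : ℕ) : ℤ)
                    * ((q : ℤ) ^ (q ^ (k - 1) + k - j - m - t) - 1)) ∧
        ((j + m < q ^ (k - 1) ∨ q ^ (k - 1) + k < j + m + 1) →
          LinCode.weightDist C j = 0)) := by
  have hqk : k ≤ q := hkm.trans hmq
  have hq3 : 3 ≤ q := hk.trans hqk
  have hNmul : (q ^ k - 1) / (q - 1) * (q - 1) = q ^ k - 1 :=
    Nat.div_mul_cancel (by simpa using Nat.sub_dvd_pow_sub_pow q 1 k)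
  have hqkpos : 0 < q ^ k := pow_pos (by omega) k
  have hN1 : (q ^ k - 1) / (q - 1) * (q - 1) + 1 = q ^ Fintype.card (Fin k) := by
    rw [Fintype.card_fin, hNmul]
    omega
  have hq2 : q * q ≤ q ^ (k - 1) := by
    rw [← pow_two]
    exact Nat.pow_le_pow_right (by omega) (by omega)
  -- Here `k ≥ 3` enters: `m ≤ q < q^2 ≤ q^(k-1)`. So no nonzero message is sent to zero in `C`.
  have hmq2 : m < q ^ (k - 1) := by nlinarith
  have hN2 : 2 ≤ (q ^ k - 1) / (q - 1) := by
    by_contra hlt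
    have h1 : (q ^ k - 1) / (q - 1) * (q - 1) ≤ 1 * (q - 1) := Nat.mul_le_mul_right _ (by omega)
    have h2 : q ^ (k - 1) ≤ q ^ k := Nat.pow_le_pow_right (by omega) (by omega)
    have h3 : 3 * q ≤ q * q := Nat.mul_le_mul_right _ hq3
    omega
  have hScol := LinCode.col_injective hS
  have hGcol := LinCode.grsMatrix_col_injective (k := k) (by omega) hγ
  -- column weights of the simplex code
  have hwS : ∀ V : Submodule F (Fin k → F), LinCode.colWeight S V * (q - 1)
      + q ^ (k - Module.finrank F V) = q ^ k := by
    intro V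
    simpa [hq] using LinCode.colWeight_mul_add_of_pairwiseIndepCols hN2 hS (hq ▸ hN1) V
  have hwSe : ∀ V : Submodule F (Fin k → F), LinCode.colWeight S V
      = (q ^ k - q ^ (k - Module.finrank F V)) / (q - 1) := fun V =>
    (Nat.div_eq_of_eq_mul_left (by omega) (by have := hwS V; omega)).symm
  have hdel : ∀ V : Submodule F (Fin k → F),
      LinCode.colWeight (LinCode.deleteCols S (LinCode.grsMatrix k m γ)) V
        + LinCode.colWeight (LinCode.grsMatrix k m γ) V
      = (q ^ k - q ^ (k - Module.finrank F V)) / (q - 1) := fun V => by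
    rw [LinCode.colWeight_deleteCols_add hScol hGcol hGS, hwSe]
  have hwGle : ∀ V : Submodule F (Fin k → F),
      LinCode.colWeight (LinCode.grsMatrix k m γ) V ≤ m := fun V => by
    simpa using LinCode.colWeight_le_card (LinCode.grsMatrix k m γ) V
  have hwGge : ∀ V : Submodule F (Fin k → F), 1 ≤ Module.finrank F V →
      m ≤ LinCode.colWeight (LinCode.grsMatrix k m γ) V + (k - Module.finrank F V) :=
    fun V hV => LinCode.le_colWeight_grsMatrix_add hγ hV
  have he1 : (q ^ k - q ^ (k - 1)) / (q - 1) = q ^ (k - 1) := by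
    refine Nat.div_eq_of_eq_mul_left (by omega) ?_
    rw [Nat.mul_sub, mul_one, ← pow_succ, Nat.sub_add_cancel (by omega)]
  have hGinj := LinCode.vecMulLinear_grsMatrix_injective hkm hγ
  have hCinj : Function.Injective
      (LinCode.deleteCols S (LinCode.grsMatrix k m γ)).vecMulLinear := by
    refine LinCode.vecMulLinear_injective_of_colWeight_pos fun V hV => ?_
    have h := hdel V
    rw [hV, he1] at h
    have := hwGle V
    omega
  have hfinC : Module.finrank F C = k := by
    rw [hC, LinCode.finrank_rowCode hCinj, Fintype.card_fin]
  have hlen : Fintype.card (LinCode.RemainingCols S (LinCode.grsMatrix k m γ)) + m = (q ^ k - 1) / (q - 1) := by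
    simpa using LinCode.card_remainingCols_add hScol hGcol hGS
  have hqQ : (1 : ℚ) < (q : ℚ) := by exact_mod_cast (show 1 < q by omega)
  have hq1Q : (q : ℚ) - 1 ≠ 0 := by linarith
  -- generalized Hamming weights
  have hghwN : ∀ r : ℕ, 1 ≤ r → r ≤ k →
      LinCode.ghw C r = (q ^ k - q ^ (k - r)) / (q - 1) - m := by
    intro r hr hrk
    -- The minimum in `C` occurs where the weight in `Ct` is maximal, namely `m`.
    obtain ⟨V, hV, hVm⟩ := LinCode.exists_colWeight_grsMatrix_eq γ hr hrk
    have hle : ∀ W : Submodule F (Fin k → F), Module.finrank F W = r →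
        (q ^ k - q ^ (k - r)) / (q - 1) - m
          ≤ LinCode.colWeight (LinCode.deleteCols S (LinCode.grsMatrix k m γ)) W := by
      rintro W rfl
      have h1 := hdel W
      have h2 := hwGle W
      omega
    rw [hC]
    refine LinCode.ghw_rowCode_eq hCinj hle hV ?_
    have h := hdel V
    rw [hV, hVm] at h
    omega
  have hghw : ∀ r : ℕ, 1 ≤ r → r ≤ k →
      (LinCode.ghw C r : ℚ) = ((q : ℚ) ^ k - (q : ℚ) ^ (k - r)) / ((q : ℚ) - 1) - (m : ℚ) := by
    intro r hr hrk
    obtain ⟨V, hV, hVm⟩ := LinCode.exists_colWeight_grsMatrix_eq γ hr hrk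
    have h1 := hwS V
    have h2 := hdel V
    rw [hV] at h1
    rw [hVm, ← hwSe V] at h2
    rw [hghwN r hr hrk, ← hV, ← hwSe V, hV, Nat.cast_sub (by omega)]
    congr 1
    rw [eq_div_iff hq1Q]
    have h3 : ((LinCode.colWeight S V * (q - 1) + q ^ (k - r) : ℕ) : ℚ) = ((q ^ k : ℕ) : ℚ) := by
      rw [h1]
    rw [Nat.cast_add, Nat.cast_mul, Nat.cast_sub (by omega : 1 ≤ q)] at h3
    push_cast at h3
    linarith
  -- Griesmer defects
  have hcardQ : ((Fintype.card (LinCode.RemainingCols S (LinCode.grsMatrix k m γ)) : ℚ) + m)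
      * ((q : ℚ) - 1) = (q : ℚ) ^ k - 1 := by
    have h3 : (((q ^ k - 1) / (q - 1) * (q - 1) + 1 : ℕ) : ℚ) = ((q ^ k : ℕ) : ℚ) := by
      rw [hN1, Fintype.card_fin]
    rw [← hlen] at h3
    rw [Nat.cast_add, Nat.cast_mul, Nat.cast_sub (by omega : 1 ≤ q)] at h3
    push_cast at h3
    linarith
  have hdef : ∀ r : ℕ, 1 ≤ r → r ≤ k → LinCode.griesmerDefect C r
      = ∑ i ∈ Finset.Icc 1 (k - r), ⌊((q : ℚ) - 1) * m / ((q : ℚ) ^ i * ((q : ℚ) ^ r - 1))⌋ :=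
    fun r hr hrk => by
      subst hq
      exact LinCode.griesmerDefect_eq_sum_floor C hr hrk hfinC hcardQ (hghw r hr hrk)
  have hfloor : ∀ r i : ℕ, 1 ≤ r → (q - 1) * m < q ^ i * (q ^ r - 1) →
      ⌊((q : ℚ) - 1) * m / ((q : ℚ) ^ i * ((q : ℚ) ^ r - 1))⌋ = 0 := by
    intro r i hr hlt
    have hltQ : (((q - 1) * m : ℕ) : ℚ) < ((q ^ i * (q ^ r - 1) : ℕ) : ℚ) := by exact_mod_cast hlt
    rw [Nat.cast_mul, Nat.cast_mul, Nat.cast_sub (by omega : 1 ≤ q),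
      Nat.cast_sub (Nat.one_le_pow _ _ (by omega))] at hltQ
    push_cast at hltQ
    have h0 : 0 ≤ ((q : ℚ) - 1) * m := mul_nonneg (by linarith) (Nat.cast_nonneg m)
    rw [Int.floor_eq_zero_iff, Set.mem_Ico]
    exact ⟨div_nonneg h0 (h0.trans hltQ.le), (div_lt_one (h0.trans_lt hltQ)).2 hltQ⟩
  have hpowle : ∀ i : ℕ, 1 ≤ i → q ≤ q ^ i := fun i hi => Nat.le_self_pow (by omega) q
  refine ⟨⟨?_, ?_, hfinC, hlen⟩, hghw, ?_, ⟨?_, ?_⟩, ?_, ?_⟩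
  · rw [hCt, LinCode.finrank_rowCode hGinj, Fintype.card_fin]
  · rw [hCt]
    exact LinCode.isMDS_rowCode_grsMatrix (by omega) hkm hγ
  · intro r hr hrk j
    rw [hC, hCt, LinCode.sswd_rowCode hCinj, LinCode.sswd_rowCode hGinj]
    refine ⟨fun hj => ?_, fun hj1 hj2 => ?_, fun hj => ?_⟩
    · rw [Set.ncard_eq_zero, Set.eq_empty_iff_forall_notMem]
      rintro V ⟨rfl, rfl⟩
      have h1 := hdel V
      have h2 := hwGle V
      omega
    · congr 1
      ext V
      simp only [Set.mem_ofPred_eq]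
      -- The complementary weight `e_r - j` is not truncated: `hj2` and `k ≤ m` give `j ≤ e_r`.
      refine and_congr_right ?_
      rintro rfl
      have h1 := hdel V
      omega
    · rw [Set.ncard_eq_zero, Set.eq_empty_iff_forall_notMem]
      rintro V ⟨rfl, rfl⟩
      have h1 := hdel V
      have h2 := hwGge V hr
      omega
  · intro hlt
    refine ⟨⟨le_rfl, by omega, ?_⟩, fun j hj => hj.1⟩
    rw [hdef 1 le_rfl (by omega)]
    refine Finset.sum_eq_zero fun i hi => hfloor 1 i le_rfl ?_
    have := hpowle i (Finset.mem_Icc.1 hi).1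
    rw [pow_one, mul_comm]
    exact Nat.mul_lt_mul_of_pos_right (by omega) (by omega)
  · intro hmeq
    have hone : LinCode.griesmerDefect C 1 = 1 := by
      rw [hdef 1 le_rfl (by omega), Finset.sum_eq_single 1]
      · have : ((q : ℚ) - 1) * m / ((q : ℚ) ^ 1 * ((q : ℚ) ^ 1 - 1)) = 1 := by
          rw [hmeq, pow_one, mul_comm]
          exact div_self (mul_ne_zero (by linarith) hq1Q)
        rw [this, Int.floor_one]
      · intro i hi hi1
        rw [Finset.mem_Icc] at hi
        refine hfloor 1 i le_rfl ?_
        have h2 : q ^ 2 ≤ q ^ i := Nat.pow_le_pow_right (by omega) (by omega)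
        rw [pow_one, mul_comm]
        exact Nat.mul_lt_mul_of_pos_right (by nlinarith) (by omega)
      · intro h
        exact absurd (Finset.mem_Icc.2 ⟨le_rfl, by omega⟩) h
    refine ⟨⟨⟨by omega, by omega, ?_⟩, ?_⟩, hone⟩
    · rw [hdef 2 (by omega) (by omega)]
      -- For `r = 2` the denominator has `q^2 - 1` in place of `q - 1`, so even the term `i = 1`
      -- drops below 1.
      refine Finset.sum_eq_zero fun i hi => hfloor 2 i (by omega) ?_
      have h1 := hpowle i (Finset.mem_Icc.1 hi).1
      have h2 : q - 1 < q ^ 2 - 1 := by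
        have : 3 * q ≤ q ^ 2 := by nlinarith
        omega
      calc (q - 1) * m ≤ q ^ i * (q - 1) := by
            rw [mul_comm]
            exact Nat.mul_le_mul_right _ (by omega)
        _ < q ^ i * (q ^ 2 - 1) := Nat.mul_lt_mul_of_pos_left h2 (by omega)
    · rintro j ⟨hj1, -, hj⟩
      by_contra hlt
      obtain rfl : j = 1 := by omega
      omega
  · rw [hC, LinCode.weightDist_rowCode hCinj]
    simp only [hammingNorm_eq_zero, map_eq_zero_iff _ hCinj]
    exact Set.ncard_singleton 0
  · intro j hj
    have hnorm : ∀ v : Fin k → F, v ≠ 0 →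
        hammingNorm ((LinCode.deleteCols S (LinCode.grsMatrix k m γ)).vecMulLinear v)
          + hammingNorm ((LinCode.grsMatrix k m γ).vecMulLinear v) = q ^ (k - 1) := by
      intro v hv
      rw [← LinCode.colWeight_span_singleton, ← LinCode.colWeight_span_singleton, hdel,
        finrank_span_singleton hv, he1]
    rw [hC, LinCode.weightDist_rowCode hCinj]
    refine ⟨fun hj1 hj2 => ?_, fun hj' => ?_⟩
    · have h := LinCode.ncard_hammingNorm_grsMatrix (k := k) hγ (w := q ^ (k - 1) - j)
        (by omega) (by omega)
      rw [hq, show k - (m - (q ^ (k - 1) - j)) = q ^ (k - 1) + k - j - m by omega] at h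
      rw [← h]
      congr 2
      ext v
      simp only [Set.mem_ofPred_eq]
      -- The zero message violates `hnorm` but lies in neither set, since both `j` and `q^(k-1) - j`
      -- are positive.
      rcases eq_or_ne v 0 with rfl | hv
      · simp only [map_zero, hammingNorm_zero]
        omega
      · have := hnorm v hv
        omega
    · rw [Set.ncard_eq_zero, Set.eq_empty_iff_forall_notMem]
      intro v hvj
      rw [Set.mem_ofPred_eq] at hvj
      have hv : v ≠ 0 := by
        rintro rfl
        rw [map_zero, hammingNorm_zero] at hvj
        omega
      have h1 := hnorm v hv
      rw [hvj] at h1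
      have h2 := hwGle (Submodule.span F {v})
      have h3 := hwGge (Submodule.span F {v}) (finrank_span_singleton hv).ge
      rw [finrank_span_singleton hv] at h3
      rw [LinCode.colWeight_span_singleton] at h2 h3
      omega
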